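/- Let $N\ge 1$ and let $\Omega\subset\mathbb{R}^N$ be a bounded open set. For $p>N$ let $\lambda_p$ be the smallest eigenvalue of the $p$-Laplacian on $\Omega$, i.e. the smallest real $\lambda$ for which $-\mathrm{div}(|\nabla u|^{p-2}\nabla u)=\lambda|u|^{p-2}u$ has a nonzero distributional solution $u\in W_0^{1,p}(\Omega)$, and let $u_p$ be an eigenfunction for $\lambda_p$, continuous on $\overline\Omega$, positive in $\Omega$ and normalised by $\int_\Omega u_p^p\,dx=1$. Put $f_p=u_p^{p-1}\,dx$. Let $(\Lambda_\infty,u_\infty,f_\infty)$ be limits of these objects along a sequence of exponents $p_k\to\infty$, $p_k>N$: $\lambda_{p_k}^{1/p_k}\to\Lambda_\infty$, $u_{p_k}\to u_\infty$ uniformly on $\overline\Omega$, and $f_{p_k}\rightharpoonup f_\infty$ weakly* in the space of finite Borel measures on $\overline\Omega$. Denote by $\mathscr P(\partial\Omega)$ the set of Borel probability measures concentrated on $\partial\Omega$, by $(\mathcal P_\infty)$ the problem $$\min\Big\{-\int_{\overline\Omega} u\,df_\infty:\ u\in \mathrm{Lip}(\Omega),\ |\nabla u|\le\Lambda_\infty\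 \text{a.e. in }\Omega,\ u=0\ \text{on }\partial\Omega\Big\},$$ and by $(\mathcal P_\infty^*)$ the problem $$\min\Big\{\Lambda_\infty\int_{\mathbb{R}^N}|\sigma|:\ \nu\in\mathscr P(\partial\Omega),\ \sigma\ \text{a bounded } \mathbb{R}^N\text{-valued Borel measure on }\mathbb{R}^N,\ -\mathrm{div}\,\sigma=f_\infty-\nu\ \text{in }\mathbb{R}^N\Big\},$$ where $|\sigma|$ is the total variation measure of $\sigma$ and the divergence equation means $\int\nabla\varphi\cdot d\sigma=\int\varphi\,df_\infty-\int\varphi\,d\nu$ for all $\varphi\in C_c^\infty(\mathbb{R}^N)$. Then $\Lambda_\infty>0$, both minima are attained, and $$\inf\Big\{\int_{\overline\Omega\times\overline\Omega}|x-y|\,d\gamma:\ \pi^1_\sharp\gamma=f_\infty,\ \pi^2_\sharp\gamma\in\mathscr P(\partial\Omega)\Big\}=-\frac1{\Lambda_\infty}\min(\mathcal P_\infty)=\frac1{\Lambda_\infty}\min(\mathcal P_\infty^*),$$ where the infimum is over Borel measures $\gamma$ on $\mathbb{R}^N\times\mathbb{R}^N$ with marginals $\pi^1_\sharp\gamma$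 and $\pi^2_\sharp\gamma$ (so that $\gamma$ is concentrated on $\overline\Omega\times\overline\Omega$). -/

import Mathlib

open MeasureTheory Filter Topology Set
open scoped ENNReal ContDiff

namespace InftyEigenvalue

/-- Euclidean space `ℝ^N`. -/
abbrev Euc (N : ℕ) : Type := EuclideanSpace ℝ (Fin N)

variable {N : ℕ}

/-- `φ ∈ C_c^∞(Ω)`: smooth functions on `ℝ^N` whose support is a compact subset of `Ω`. -/
def IsTestFunction (Ω : Set (Euc N)) (φ : Euc N → ℝ) : Prop :=
  ContDiff ℝ ∞ φ ∧ HasCompactSupport φ ∧ tsupport φ ⊆ Ω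

/-- `u ∈ W_0^{1,p}(Ω)` with weak gradient `G`: the pair `(u, G)` is a limit in
`L^p(Ω) × L^p(Ω; ℝ^N)` of pairs `(φ_n, ∇φ_n)` with `φ_n ∈ C_c^∞(Ω)`. -/
def MemW0WithGrad (Ω : Set (Euc N)) (p : ℝ) (u : Euc N → ℝ) (G : Euc N → Euc N) : Prop :=
  MemLp u (ENNReal.ofReal p) (volume.restrict Ω) ∧
  MemLp G (ENNReal.ofReal p) (volume.restrict Ω) ∧
  ∃ φ : ℕ → Euc N → ℝ, (∀ n, IsTestFunction Ω (φ n)) ∧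
    Tendsto (fun n => eLpNorm (fun x => φ n x - u x) (ENNReal.ofReal p) (volume.restrict Ω))
      atTop (𝓝 0) ∧
    Tendsto (fun n => eLpNorm (fun x => gradient (φ n) x - G x) (ENNReal.ofReal p)
      (volume.restrict Ω)) atTop (𝓝 0)

/-- `u ∈ W_0^{1,p}(Ω)` solves `-div(|∇u|^{p-2} ∇u) = lam |u|^{p-2} u` in `Ω` in the sense of
distributions. -/
def SolvesPLaplace (Ω : Set (Euc N)) (p lam : ℝ) (u : Euc N → ℝ) : Prop :=
  ∃ G : Euc N → Euc N, MemW0WithGrad Ω p u G ∧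
    ∀ φ : Euc N → ℝ, IsTestFunction Ω φ →
      ∫ x in Ω, ‖G x‖ ^ (p - 2) * inner ℝ (G x) (gradient φ x) =
        lam * ∫ x in Ω, |u x| ^ (p - 2) * u x * φ x

/-- `lam` is an eigenvalue of the `p`-Laplacian on `Ω` (with zero Dirichlet condition). -/
def IsEigenvalue (Ω : Set (Euc N)) (p lam : ℝ) : Prop :=
  ∃ u : Euc N → ℝ, SolvesPLaplace Ω p lam u ∧ ¬ (u =ᵐ[volume.restrict Ω] 0)

/-- The first (smallest) eigenvalue `λ_p` of the `p`-Laplacian on `Ω`. -/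
noncomputable def firstEigenvalue (Ω : Set (Euc N)) (p : ℝ) : ℝ :=
  sInf {lam : ℝ | IsEigenvalue Ω p lam}

/-- `u` is (the continuous representative of) a positive eigenfunction for the first eigenvalue,
normalised in `L^p(Ω)`; here `p > N`, so that elements of `W_0^{1,p}(Ω)` are continuous on
the closure of `Ω`. -/
def IsFirstEigenfunction (Ω : Set (Euc N)) (p : ℝ) (u : Euc N → ℝ) : Prop :=
  SolvesPLaplace Ω p (firstEigenvalue Ω p) u ∧
  ContinuousOn u (closure Ω) ∧ (∀ x ∈ Ω, 0 < u x) ∧ ∫ x in Ω, u x ^ p = 1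

/-- `(Lam, uinf, f)` is a limit `(Λ_∞, u_∞, f_∞)` obtained along a sequence of exponents
`p_k → ∞`, `p_k > N`, with `u k` the normalised positive first eigenfunction for `p k`:
`λ_{p_k}^{1/p_k} → Λ_∞`, `u_{p_k} → u_∞` uniformly on the closure of `Ω`, and
`f_{p_k} = u_{p_k}^{p_k - 1} dx` converges weakly* to `f_∞` in the space of finite measures on the
closure of `Ω` (that `f_∞` has mass one and that `Λ_∞ > 0` is not part of the definition). -/
structure IsLimit (Ω : Set (Euc N)) (p : ℕ → ℝ) (u : ℕ → Euc N → ℝ)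
    (Lam : ℝ) (uinf : Euc N → ℝ) (f : Measure (Euc N)) : Prop where
  dim_lt : ∀ k, (N : ℝ) < p k
  exponent_tendsto : Tendsto p atTop atTop
  eigenfunction : ∀ k, IsFirstEigenfunction Ω (p k) (u k)
  eigenvalue_tendsto : Tendsto (fun k => firstEigenvalue Ω (p k) ^ (1 / p k)) atTop (𝓝 Lam)
  uniform_tendsto : TendstoUniformlyOn u uinf atTop (closure Ω)
  finite : IsFiniteMeasure f
  concentrated : f (closure Ω)ᶜ = 0
  weak_tendsto : ∀ φ : Euc N → ℝ, Continuous φ →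
    Tendsto (fun k => ∫ x in Ω, φ x * u k x ^ (p k - 1)) atTop (𝓝 (∫ x, φ x ∂f))

/-- The set `𝒫(S)` of Borel probability measures concentrated on `S`. -/
def ProbOn (S : Set (Euc N)) : Set (Measure (Euc N)) :=
  {ν | IsProbabilityMeasure ν ∧ ν Sᶜ = 0}

/-- The values `∫ |x - y| dγ` over all transport plans `γ` from `f` to
some probability measure on the boundary of `Ω`. -/
def kantorovichValues (Ω : Set (Euc N)) (f : Measure (Euc N)) : Set ℝ :=
  {r | ∃ γ : Measure (Euc N × Euc N),
    γ.map Prod.fst = f ∧ γ.map Prod.snd ∈ ProbOn (frontier Ω) ∧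
    r = ∫ z in closure Ω ×ˢ closure Ω, ‖z.1 - z.2‖ ∂γ}

/-- Admissible functions of `(P_∞)`: `u ∈ Lip(Ω)` (given with its values on the closure),
`|∇u| ≤ Lam` a.e. in `Ω`, `u = 0` on the boundary. -/
def IsAdmissible (Ω : Set (Euc N)) (Lam : ℝ) (u : Euc N → ℝ) : Prop :=
  (∃ K, LipschitzOnWith K u (closure Ω)) ∧
  (∀ᵐ x ∂(volume.restrict Ω), ‖gradient u x‖ ≤ Lam) ∧
  ∀ x ∈ frontier Ω, u x = 0

/-- The values of the objective `-⟨f, u⟩` of `(P_∞)`. -/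
def primalValues (Ω : Set (Euc N)) (Lam : ℝ) (f : Measure (Euc N)) : Set ℝ :=
  {r | ∃ u : Euc N → ℝ, IsAdmissible Ω Lam u ∧ r = -∫ x in closure Ω, u x ∂f}

/-- `-div σ = f - ν` in `ℝ^N` in the sense of distributions: `∫ ∇φ · dσ = ∫ φ d(f - ν)` for all
`φ ∈ C_c^∞(ℝ^N)`. -/
def NegDivEq (σ : VectorMeasure (Euc N) (Euc N)) (f ν : Measure (Euc N)) : Prop :=
  ∀ φ : Euc N → ℝ, IsTestFunction univ φ →
    σ.integral (fun x => gradient φ x) (innerSL ℝ) = ∫ x, φ x ∂f - ∫ x, φ x ∂ν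

/-- The values of the objective `Lam ∫ |σ|` of `(P_∞^*)`, over `ν ∈ 𝒫(∂Ω)` and bounded
`ℝ^N`-valued measures `σ` with `-div σ = f - ν` in `ℝ^N`. -/
def dualValues (Ω : Set (Euc N)) (Lam : ℝ) (f : Measure (Euc N)) : Set ℝ :=
  {r | ∃ ν ∈ ProbOn (frontier Ω), ∃ σ : VectorMeasure (Euc N) (Euc N),
    σ.variation univ ≠ ⊤ ∧ NegDivEq σ f ν ∧ r = Lam * (σ.variation univ).toReal}

end InftyEigenvalue

/-!
All three values are computed by the distance `d(x) = dist (x, Ωᶜ)`, which on the closure of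
`Ω` is the distance to the boundary: the primal minimum is `-Λ_∞ ∫ d df_∞`, the dual one is
`Λ_∞ ∫ d df_∞`, and the transport cost is `∫ d df_∞`. Indeed `|∇u| ≤ Λ_∞` with `u = 0` on the
boundary forces `|u| ≤ Λ_∞ d`, with equality for `u = Λ_∞ d`. A plan ending on the boundary costs
at least `∫ d df_∞`, with equality for a measurable nearest-point map. Spreading such a plan over
segments produces a flux `σ` of total variation at most `∫ d df_∞`; testing the divergence equation
with mollifications of `d` shows that no competitor does better.

That `Λ_∞ > 0` comes from Poincaré's inequality with a constant independent of `p`: if the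
translate `Ω + v` misses `Ω`, then `‖φ‖_p ≤ |v| ‖∇φ‖_p` for test functions `φ`, so that
`1 ≤ |v| λ_p^{1/p}`. That `f_∞` has mass one follows from two bounds on `∫ u_p^{p-1}`: Young's
inequality bounds it above by `1 + o(1)`, and since `∫ u_p^p = 1` forces `u_∞ ≤ 1`, the inequality
`u_p^p ≤ (1 + ε) u_p^{p-1}` bounds it below.
-/

namespace InftyEigenvalue

section UnitLpNorm

variable {α : Type*} [MeasurableSpace α] {μ : Measure α}

lemma ae_le_one_of_tendsto_of_lintegral_rpow_le {v : ℕ → α → ℝ} {w : α → ℝ} {p : ℕ → ℝ}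
    {C : ℝ≥0∞} (hv : ∀ k, AEMeasurable (v k) μ) (hp : Tendsto p atTop atTop) (hC : C ≠ ⊤)
    (hbound : ∀ k, ∫⁻ x, ENNReal.ofReal (v k x ^ p k) ∂μ ≤ C)
    (hvw : ∀ᵐ x ∂μ, Tendsto (fun k => v k x) atTop (𝓝 (w x))) : ∀ᵐ x ∂μ, w x ≤ 1 := by
  have hmeas (k : ℕ) : AEMeasurable (fun x => ENNReal.ofReal (v k x ^ p k)) μ :=
    ((hv k).pow_const _).ennreal_ofReal
  have hfatou : ∫⁻ x, liminf (fun k => ENNReal.ofReal (v k x ^ p k)) atTop ∂μ ≤ C :=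
    (lintegral_liminf_le' hmeas).trans <|
      (liminf_le_liminf (Eventually.of_forall hbound)).trans_eq (liminf_const C)
  have hmeas_liminf :
      AEMeasurable (fun x => liminf (fun k => ENNReal.ofReal (v k x ^ p k)) atTop) μ := by
    simp only [liminf_eq_iSup_iInf_of_nat]
    exact .iSup fun n => .biInf _ (to_countable _) fun k _ => hmeas k
  filter_upwards [ae_lt_top' hmeas_liminf (hfatou.trans_lt hC.lt_top).ne, hvw] with x hx hxw
  by_contra! hlt
  obtain ⟨a, ha, haw⟩ := exists_between hlt
  have hgrow : Tendsto (fun k => ENNReal.ofReal (v k x ^ p k)) atTop (𝓝 ⊤) := by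
    refine ENNReal.tendsto_ofReal_atTop.comp ?_
    refine tendsto_atTop_mono' _ ?_ ((tendsto_rpow_atTop_of_base_gt_one a ha).comp hp)
    filter_upwards [hxw.eventually_const_lt haw, hp.eventually_ge_atTop 0] with k hk hpk
    exact Real.rpow_le_rpow (by linarith) hk.le hpk
  exact hx.ne hgrow.liminf_eq

lemma rpow_sub_one_le {a p : ℝ} (ha : 0 ≤ a) (hp : 1 ≤ p) :
    a ^ (p - 1) ≤ (p - 1) / p * a ^ p + 1 / p := by
  have hp0 : 0 < p := by linarith
  have young := Real.geom_mean_le_arith_mean2_weighted (w₁ := (p - 1) / p) (w₂ := 1 / p)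
    (p₁ := a ^ p) (p₂ := 1) (div_nonneg (by linarith) hp0.le) (by positivity)
    (Real.rpow_nonneg ha _) zero_le_one (by field_simp; ring)
  rwa [← Real.rpow_mul ha, mul_div_cancel₀ _ hp0.ne', Real.one_rpow, mul_one, mul_one] at young

lemma integrable_rpow_sub_one [IsFiniteMeasure μ] {v : α → ℝ} {p : ℝ}
    (hv : AEStronglyMeasurable v μ) (hv0 : 0 ≤ᵐ[μ] v) (hp : 1 ≤ p)
    (hint : Integrable (fun x => v x ^ p) μ) : Integrable (fun x => v x ^ (p - 1)) μ := by
  refine ((hint.const_mul ((p - 1) / p)).add (integrable_const (1 / p))).mono'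
    (hv.aemeasurable.pow_const _).aestronglyMeasurable ?_
  filter_upwards [hv0] with x hx
  rw [Real.norm_of_nonneg (Real.rpow_nonneg hx _)]
  exact rpow_sub_one_le hx hp

lemma integral_rpow_sub_one_le [IsFiniteMeasure μ] {v : α → ℝ} {p : ℝ}
    (hv : AEStronglyMeasurable v μ) (hv0 : 0 ≤ᵐ[μ] v) (hp : 1 ≤ p)
    (hint : Integrable (fun x => v x ^ p) μ) :
    ∫ x, v x ^ (p - 1) ∂μ ≤ (p - 1) / p * ∫ x, v x ^ p ∂μ + μ.real univ / p := by
  have hint' := hint.const_mul ((p - 1) / p)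
  calc ∫ x, v x ^ (p - 1) ∂μ
      ≤ ∫ x, ((p - 1) / p * v x ^ p + 1 / p) ∂μ :=
        integral_mono_ae (integrable_rpow_sub_one hv hv0 hp hint)
          (hint'.add (integrable_const _)) (hv0.mono fun x hx => rpow_sub_one_le hx hp)
    _ = (p - 1) / p * ∫ x, v x ^ p ∂μ + μ.real univ / p := by
        rw [integral_add hint' (integrable_const _), integral_const_mul, integral_const,
          smul_eq_mul, mul_one_div]

lemma integral_rpow_le_integral_rpow_sub_one_mul [IsFiniteMeasure μ] {v : α → ℝ} {p C : ℝ}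
    (hv : AEStronglyMeasurable v μ) (hv0 : 0 ≤ᵐ[μ] v) (hp : 1 ≤ p)
    (hint : Integrable (fun x => v x ^ p) μ) (hvC : ∀ᵐ x ∂μ, v x ≤ C) :
    ∫ x, v x ^ p ∂μ ≤ (∫ x, v x ^ (p - 1) ∂μ) * C := by
  rw [← integral_mul_const]
  refine integral_mono_ae hint ((integrable_rpow_sub_one hv hv0 hp hint).mul_const _) ?_
  filter_upwards [hv0, hvC] with x hx hxC
  calc v x ^ p = v x ^ (p - 1) * v x := by
        rw [← Real.rpow_add_one' hx (by linarith), sub_add_cancel]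
    _ ≤ v x ^ (p - 1) * C := mul_le_mul_of_nonneg_left hxC (Real.rpow_nonneg hx _)

theorem tendsto_integral_rpow_sub_one [IsFiniteMeasure μ] {v : ℕ → α → ℝ} {w : α → ℝ}
    {p : ℕ → ℝ} {s : Set α} (hv : ∀ k, AEStronglyMeasurable (v k) μ) (hv0 : ∀ k, 0 ≤ᵐ[μ] v k)
    (hp : Tendsto p atTop atTop) (hnorm : ∀ k, ∫ x, v k x ^ p k ∂μ = 1)
    (hs : ∀ᵐ x ∂μ, x ∈ s) (hvw : TendstoUniformlyOn v w atTop s) :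
    Tendsto (fun k => ∫ x, v k x ^ (p k - 1) ∂μ) atTop (𝓝 1) := by
  have hint (k : ℕ) : Integrable (fun x => v k x ^ p k) μ :=
    .of_integral_ne_zero (by rw [hnorm k]; exact one_ne_zero)
  have hw : ∀ᵐ x ∂μ, w x ≤ 1 := by
    refine ae_le_one_of_tendsto_of_lintegral_rpow_le (C := 1) (fun k => (hv k).aemeasurable) hp
      ENNReal.one_ne_top (fun k => ?_) (hs.mono fun x hx => hvw.tendsto_at hx)
    rw [← ofReal_integral_eq_lintegral_ofReal (hint k)
      ((hv0 k).mono fun x hx => Real.rpow_nonneg hx _), hnorm k, ENNReal.ofReal_one]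
  refine tendsto_order.2 ⟨fun a ha => ?_, fun a ha => ?_⟩
  · have hε : 0 < (1 - a) / 2 := by linarith
    filter_upwards [Metric.tendstoUniformlyOn_iff.1 hvw _ hε, hp.eventually_ge_atTop 1]
      with k hk hpk
    have hvk : ∀ᵐ x ∂μ, v k x ≤ 1 + (1 - a) / 2 := by
      filter_upwards [hs, hw] with x hx hwx
      have := hk x hx
      rw [Real.dist_eq] at this
      linarith [(abs_lt.1 this).1]
    have := integral_rpow_le_integral_rpow_sub_one_mul (hv k) (hv0 k) hpk (hint k) hvk
    rw [hnorm k] at this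
    nlinarith
  · have hinv : Tendsto (fun k => 1 + (μ.real univ - 1) / p k) atTop (𝓝 1) := by
      simpa using (hp.const_div_atTop (μ.real univ - 1)).const_add 1
    filter_upwards [hinv.eventually_lt_const ha, hp.eventually_ge_atTop 1] with k hk hpk
    refine (integral_rpow_sub_one_le (hv k) (hv0 k) hpk (hint k)).trans_lt (lt_of_eq_of_lt ?_ hk)
    rw [hnorm k]
    field_simp
    ring

end UnitLpNorm

section LpConvergence

variable {α E F G : Type*} [MeasurableSpace α] {μ : Measure α} [NormedAddCommGroup E]
  [NormedAddCommGroup F] {p q : ℝ≥0∞}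

lemma tendsto_eLpNorm_of_tendsto_eLpNorm_sub [Fact (1 ≤ p)] {φ : ℕ → α → E} {u : α → E}
    (hφ : ∀ n, MemLp (φ n) p μ) (hu : MemLp u p μ)
    (h : Tendsto (fun n => eLpNorm (φ n - u) p μ) atTop (𝓝 0)) :
    Tendsto (fun n => eLpNorm (φ n) p μ) atTop (𝓝 (eLpNorm u p μ)) := by
  have := ((Lp.tendsto_Lp_iff_tendsto_eLpNorm'' φ hφ u hu).2 h).enorm
  simpa only [Lp.enorm_toLp] using this

variable [NormedSpace ℝ E] [NormedSpace ℝ F] [NormedAddCommGroup G] [NormedSpace ℝ G]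
  [CompleteSpace G]

lemma tendsto_integral_bilin [p.HolderConjugate q] (B : E →L[ℝ] F →L[ℝ] G) {f : α → E}
    {φ : ℕ → α → F} {u : α → F} (hf : MemLp f p μ) (hφ : ∀ n, MemLp (φ n) q μ) (hu : MemLp u q μ)
    (h : Tendsto (fun n => eLpNorm (φ n - u) q μ) atTop (𝓝 0)) :
    Tendsto (fun n => ∫ x, B (f x) (φ n x) ∂μ) atTop (𝓝 (∫ x, B (f x) (u x) ∂μ)) := by
  have : Fact (1 ≤ p) := ⟨ENNReal.HolderConjugate.one_le p q⟩
  have : Fact (1 ≤ q) := ⟨ENNReal.HolderConjugate.one_le q p⟩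
  have pairing {g : α → F} (hg : MemLp g q μ) :
      B.lpPairing μ p q (hf.toLp f) (hg.toLp g) = ∫ x, B (f x) (g x) ∂μ := by
    rw [ContinuousLinearMap.lpPairing_eq_integral]
    refine integral_congr_ae ?_
    filter_upwards [hf.coeFn_toLp, hg.coeFn_toLp] with x hfx hgx
    rw [hfx, hgx]
  have := ((B.lpPairing μ p q (hf.toLp f)).continuous.tendsto _).comp
    ((Lp.tendsto_Lp_iff_tendsto_eLpNorm'' φ hφ u hu).2 h)
  simpa only [Function.comp_def, pairing] using this

end LpConvergence

section SegmentFTC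

variable {E F : Type*} [NormedAddCommGroup E] [NormedSpace ℝ E] [NormedAddCommGroup F]
  [NormedSpace ℝ F] [CompleteSpace F]

lemma integral_fderiv_add_smul {φ : E → F} (hφ : ContDiff ℝ 1 φ) (x v : E) :
    ∫ t in (0 : ℝ)..1, fderiv ℝ φ (x + t • v) v = φ (x + v) - φ x := by
  have hderiv (t : ℝ) : HasDerivAt (fun t : ℝ => φ (x + t • v)) (fderiv ℝ φ (x + t • v) v) t := by
    have hline : HasDerivAt (fun t : ℝ => x + t • v) v t := by
      simpa using ((hasDerivAt_id t).smul_const v).const_add x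
    exact ((hφ.differentiable one_ne_zero) _).hasFDerivAt.comp_hasDerivAt t hline
  have hcont : Continuous fun t : ℝ => fderiv ℝ φ (x + t • v) v :=
    ((hφ.continuous_fderiv one_ne_zero).comp (by fun_prop)).clm_apply continuous_const
  simpa using intervalIntegral.integral_eq_sub_of_hasDerivAt (a := 0) (b := 1)
    (fun t _ => hderiv t) (hcont.intervalIntegrable _ _)

end SegmentFTC

section Poincare

variable {E F : Type*} [NormedAddCommGroup E] [NormedSpace ℝ E] [NormedAddCommGroup F]
  [NormedSpace ℝ F] [CompleteSpace F] {φ : E → F} {v : E}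

lemma enorm_rpow_le_lintegral_fderiv (hφ : ContDiff ℝ 1 φ) {x : E} (hx : φ (x + v) = 0)
    {p : ℝ} (hp : 1 ≤ p) :
    ‖φ x‖ₑ ^ p ≤ ‖v‖ₑ ^ p * ∫⁻ t in Ioc (0 : ℝ) 1, ‖fderiv ℝ φ (x + t • v)‖ₑ ^ p := by
  have hp0 : 0 < p := by linarith
  have hcont : Continuous fun t : ℝ => fderiv ℝ φ (x + t • v) :=
    (hφ.continuous_fderiv one_ne_zero).comp (by fun_prop)
  have : IsProbabilityMeasure (volume.restrict (Ioc (0 : ℝ) 1)) := ⟨by simp⟩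
  have hftc := integral_fderiv_add_smul hφ x v
  rw [hx, zero_sub, intervalIntegral.integral_of_le zero_le_one] at hftc
  have hbound : ‖φ x‖ₑ ≤ ‖v‖ₑ * ∫⁻ t in Ioc (0 : ℝ) 1, ‖fderiv ℝ φ (x + t • v)‖ₑ := calc
    ‖φ x‖ₑ = ‖∫ t in Ioc (0 : ℝ) 1, fderiv ℝ φ (x + t • v) v‖ₑ := by rw [hftc, enorm_neg]
    _ ≤ ∫⁻ t in Ioc (0 : ℝ) 1, ‖fderiv ℝ φ (x + t • v) v‖ₑ := enorm_integral_le_lintegral_enorm _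
    _ ≤ ∫⁻ t in Ioc (0 : ℝ) 1, ‖fderiv ℝ φ (x + t • v)‖ₑ * ‖v‖ₑ :=
        lintegral_mono fun t => ContinuousLinearMap.le_opENorm _ _
    _ = ‖v‖ₑ * ∫⁻ t in Ioc (0 : ℝ) 1, ‖fderiv ℝ φ (x + t • v)‖ₑ := by
        rw [lintegral_mul_const' _ _ enorm_ne_top, mul_comm]
  have hjensen := eLpNorm'_le_eLpNorm'_of_exponent_le one_pos hp hcont.aestronglyMeasurable
    (μ := volume.restrict (Ioc (0 : ℝ) 1))
  simp only [eLpNorm'_eq_lintegral_enorm, ENNReal.rpow_one, div_one] at hjensen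
  calc ‖φ x‖ₑ ^ p
      ≤ (‖v‖ₑ * (∫⁻ t in Ioc (0 : ℝ) 1, ‖fderiv ℝ φ (x + t • v)‖ₑ ^ p) ^ (1 / p)) ^ p := by
        gcongr
        exact hbound.trans (by gcongr)
    _ = ‖v‖ₑ ^ p * ∫⁻ t in Ioc (0 : ℝ) 1, ‖fderiv ℝ φ (x + t • v)‖ₑ ^ p := by
        rw [ENNReal.mul_rpow_of_nonneg _ _ hp0.le, ← ENNReal.rpow_mul,
          one_div_mul_cancel hp0.ne', ENNReal.rpow_one]

open scoped Pointwise in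
lemma exists_forall_add_notMem_of_isBounded [Nontrivial E] {s : Set E}
    (hs : Bornology.IsBounded s) : ∃ v : E, ∀ x ∈ s, x + v ∉ s := by
  obtain ⟨v, hv⟩ : ∃ v : E, v ∉ s - s := by
    by_contra! h
    exact NormedSpace.unbounded_univ ℝ E ((hs.sub hs).subset fun v _ => h v)
  exact ⟨v, fun x hx hxv => hv (mem_sub.2 ⟨x + v, hxv, x, hx, add_sub_cancel_left x v⟩)⟩

variable [MeasurableSpace E] [BorelSpace E] {μ : Measure E} [SFinite μ] [μ.IsAddRightInvariant]

lemma lintegral_enorm_rpow_le_lintegral_fderiv (hφ : ContDiff ℝ 1 φ)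
    (hv : ∀ x, φ x ≠ 0 → φ (x + v) = 0) {p : ℝ} (hp : 1 ≤ p) :
    ∫⁻ x, ‖φ x‖ₑ ^ p ∂μ ≤ ‖v‖ₑ ^ p * ∫⁻ x, ‖fderiv ℝ φ x‖ₑ ^ p ∂μ := by
  have hp0 : 0 < p := by linarith
  have hcont : Continuous fun z : E × ℝ => fderiv ℝ φ (z.1 + z.2 • v) :=
    (hφ.continuous_fderiv one_ne_zero).comp (by fun_prop)
  calc ∫⁻ x, ‖φ x‖ₑ ^ p ∂μ
      ≤ ∫⁻ x, (‖v‖ₑ ^ p * ∫⁻ t in Ioc (0 : ℝ) 1, ‖fderiv ℝ φ (x + t • v)‖ₑ ^ p) ∂μ := by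
        refine lintegral_mono fun x => ?_
        rcases eq_or_ne (φ x) 0 with hx | hx
        · simp [hx, hp0]
        · exact enorm_rpow_le_lintegral_fderiv hφ (hv x hx) hp
    _ = ‖v‖ₑ ^ p * ∫⁻ t in Ioc (0 : ℝ) 1, (∫⁻ x, ‖fderiv ℝ φ (x + t • v)‖ₑ ^ p ∂μ) := by
        rw [lintegral_const_mul' _ _ (ENNReal.rpow_ne_top_of_nonneg hp0.le enorm_ne_top),
          lintegral_lintegral_swap (hcont.enorm.measurable.pow_const _).aemeasurable]
    _ = ‖v‖ₑ ^ p * ∫⁻ x, ‖fderiv ℝ φ x‖ₑ ^ p ∂μ := by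
        simp [lintegral_add_right_eq_self fun x => ‖fderiv ℝ φ x‖ₑ ^ p]

theorem eLpNorm_le_enorm_mul_eLpNorm_fderiv (hφ : ContDiff ℝ 1 φ)
    (hv : ∀ x, φ x ≠ 0 → φ (x + v) = 0) {p : ℝ} (hp : 1 ≤ p) :
    eLpNorm φ (ENNReal.ofReal p) μ ≤ ‖v‖ₑ * eLpNorm (fderiv ℝ φ) (ENNReal.ofReal p) μ := by
  have hp0 : 0 < p := by linarith
  simp only [eLpNorm_eq_lintegral_rpow_enorm_toReal (ENNReal.ofReal_pos.2 hp0).ne'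
    ENNReal.ofReal_ne_top, ENNReal.toReal_ofReal hp0.le]
  refine (ENNReal.rpow_le_rpow (lintegral_enorm_rpow_le_lintegral_fderiv hφ hv hp)
    (by positivity)).trans_eq ?_
  rw [ENNReal.mul_rpow_of_nonneg _ _ (by positivity), ← ENNReal.rpow_mul,
    mul_one_div_cancel hp0.ne', ENNReal.rpow_one]

end Poincare

section NormPower

variable {α V : Type*} [MeasurableSpace α] {μ : Measure α} [NormedAddCommGroup V]
  [InnerProductSpace ℝ V] {p : ℝ}

lemma norm_norm_rpow_sub_two_smul (hp : 1 < p) (v : V) : ‖‖v‖ ^ (p - 2) • v‖ = ‖v‖ ^ (p - 1) := by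
  rw [norm_smul, Real.norm_of_nonneg (by positivity),
    ← Real.rpow_add_one' (norm_nonneg v) (by linarith)]
  ring_nf

lemma inner_norm_rpow_sub_two_smul_self (hp : p ≠ 0) (v : V) :
    inner ℝ (‖v‖ ^ (p - 2) • v) v = ‖v‖ ^ p := by
  rw [real_inner_smul_left, real_inner_self_eq_norm_sq, ← Real.rpow_natCast,
    ← Real.rpow_add' (norm_nonneg v) (by simpa using hp)]
  norm_num

lemma memLp_norm_rpow_sub_two_smul (hp : 1 < p) {g : α → V} (hg : MemLp g (ENNReal.ofReal p) μ) :
    MemLp (fun x => ‖g x‖ ^ (p - 2) • g x) (ENNReal.ofReal p.conjExponent) μ := by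
  have hpow := hg.norm_rpow_div (ENNReal.ofReal (p - 1))
  rw [ENNReal.toReal_ofReal (by linarith), ← ENNReal.ofReal_div_of_pos (by linarith)] at hpow
  refine hpow.of_le ((hg.1.norm.aemeasurable.pow_const _).aestronglyMeasurable.smul hg.1)
    (ae_of_all _ fun x => ?_)
  rw [norm_norm_rpow_sub_two_smul hp, Real.norm_of_nonneg (by positivity)]

lemma tendsto_integral_inner_norm_rpow_sub_two_smul (hp : 1 < p) {g : α → V} {φ : ℕ → α → V}
    (hg : MemLp g (ENNReal.ofReal p) μ) (hφ : ∀ n, MemLp (φ n) (ENNReal.ofReal p) μ)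
    (h : Tendsto (fun n => eLpNorm (φ n - g) (ENNReal.ofReal p) μ) atTop (𝓝 0)) :
    Tendsto (fun n => ∫ x, inner ℝ (‖g x‖ ^ (p - 2) • g x) (φ n x) ∂μ) atTop
      (𝓝 (∫ x, ‖g x‖ ^ p ∂μ)) := by
  have := (Real.HolderConjugate.conjExponent hp).symm.ennrealOfReal
  simp only [← inner_norm_rpow_sub_two_smul_self (by linarith : p ≠ 0)]
  exact tendsto_integral_bilin (innerSL ℝ) (memLp_norm_rpow_sub_two_smul hp hg) hφ hg h

end NormPower

section TestFunction

variable {N : ℕ} {Ω : Set (Euc N)} {φ : Euc N → ℝ}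

lemma norm_gradient (φ : Euc N → ℝ) (x : Euc N) : ‖gradient φ x‖ = ‖fderiv ℝ φ x‖ :=
  LinearIsometryEquiv.norm_map _ _

lemma IsTestFunction.contDiff_one (h : IsTestFunction Ω φ) : ContDiff ℝ 1 φ :=
  h.1.of_le (by simp)

lemma IsTestFunction.eq_zero_of_notMem (h : IsTestFunction Ω φ) {x : Euc N} (hx : x ∉ Ω) :
    φ x = 0 :=
  image_eq_zero_of_notMem_tsupport fun hx' => hx (h.2.2 hx')

lemma IsTestFunction.continuous_gradient (h : IsTestFunction Ω φ) :
    Continuous (gradient φ) :=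
  (LinearIsometryEquiv.continuous _).comp (h.contDiff_one.continuous_fderiv one_ne_zero)

lemma IsTestFunction.hasCompactSupport_gradient (h : IsTestFunction Ω φ) :
    HasCompactSupport (gradient φ) :=
  (h.2.1.fderiv ℝ).comp_left (g := (InnerProductSpace.toDual ℝ (Euc N)).symm) (map_zero _)

lemma IsTestFunction.integrable (h : IsTestFunction Ω φ) (μ : Measure (Euc N))
    [IsFiniteMeasureOnCompacts μ] : Integrable φ μ :=
  h.1.continuous.integrable_of_hasCompactSupport h.2.1

lemma IsTestFunction.memLp (h : IsTestFunction Ω φ) (p : ℝ≥0∞) (μ : Measure (Euc N))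
    [IsFiniteMeasureOnCompacts μ] : MemLp φ p μ :=
  h.1.continuous.memLp_of_hasCompactSupport h.2.1

lemma IsTestFunction.memLp_gradient (h : IsTestFunction Ω φ) (p : ℝ≥0∞) (μ : Measure (Euc N))
    [IsFiniteMeasureOnCompacts μ] : MemLp (gradient φ) p μ :=
  h.continuous_gradient.memLp_of_hasCompactSupport h.hasCompactSupport_gradient

lemma IsTestFunction.eLpNorm_le_eLpNorm_gradient (h : IsTestFunction Ω φ) {v : Euc N}
    (hv : ∀ x ∈ Ω, x + v ∉ Ω) {p : ℝ} (hp : 1 ≤ p) :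
    eLpNorm φ (ENNReal.ofReal p) (volume.restrict Ω) ≤
      ‖v‖ₑ * eLpNorm (gradient φ) (ENNReal.ofReal p) (volume.restrict Ω) := by
  have hfderiv : Function.support (fderiv ℝ φ) ⊆ Ω := (support_fderiv_subset ℝ).trans h.2.2
  rw [eLpNorm_congr_norm_ae (g := fderiv ℝ φ) (ae_of_all _ (norm_gradient φ)),
    eLpNorm_restrict_eq_of_support_subset ((subset_tsupport φ).trans h.2.2),
    eLpNorm_restrict_eq_of_support_subset hfderiv]
  refine eLpNorm_le_enorm_mul_eLpNorm_fderiv h.contDiff_one (fun x hx => ?_) hp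
  exact h.eq_zero_of_notMem (hv x (by_contra fun hxΩ => hx (h.eq_zero_of_notMem hxΩ)))

end TestFunction

section FirstEigenvalue

variable {N : ℕ} {Ω : Set (Euc N)}

lemma MemW0WithGrad.eLpNorm_le_eLpNorm_grad {p : ℝ} {u : Euc N → ℝ} {G : Euc N → Euc N}
    (h : MemW0WithGrad Ω p u G) (hp : 1 ≤ p) {v : Euc N} (hv : ∀ x ∈ Ω, x + v ∉ Ω) :
    eLpNorm u (ENNReal.ofReal p) (volume.restrict Ω) ≤
      ‖v‖ₑ * eLpNorm G (ENNReal.ofReal p) (volume.restrict Ω) := by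
  obtain ⟨hu, hG, φ, hφ, hφu, hφG⟩ := h
  have : Fact (1 ≤ ENNReal.ofReal p) := ⟨by simpa using hp⟩
  exact le_of_tendsto_of_tendsto'
    (tendsto_eLpNorm_of_tendsto_eLpNorm_sub (fun n => (hφ n).memLp _ _) hu hφu)
    (ENNReal.Tendsto.const_mul (tendsto_eLpNorm_of_tendsto_eLpNorm_sub
      (fun n => (hφ n).memLp_gradient _ _) hG hφG) (Or.inr enorm_ne_top))
    fun n => (hφ n).eLpNorm_le_eLpNorm_gradient hv hp

-- The equation may be tested with `u` itself, by density of the test functions.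
lemma SolvesPLaplace.exists_integral_norm_grad_rpow_eq {p lam : ℝ} (hp : 1 < p) {u : Euc N → ℝ}
    (h : SolvesPLaplace Ω p lam u) : ∃ G : Euc N → Euc N, MemW0WithGrad Ω p u G ∧
      ∫ x in Ω, ‖G x‖ ^ p = lam * ∫ x in Ω, |u x| ^ p := by
  obtain ⟨G, hW, heq⟩ := h
  refine ⟨G, hW, ?_⟩
  obtain ⟨hu, hG, φ, hφ, hφu, hφG⟩ := hW
  have hlhs := tendsto_integral_inner_norm_rpow_sub_two_smul hp hG
    (fun n => (hφ n).memLp_gradient _ _) hφG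
  have hrhs := (tendsto_integral_inner_norm_rpow_sub_two_smul hp hu
    (fun n => (hφ n).memLp _ _) hφu).const_mul lam
  refine tendsto_nhds_unique (hlhs.congr fun n => ?_) hrhs
  simp only [real_inner_smul_left, heq (φ n) (hφ n)]
  simp [mul_assoc, mul_comm (φ n _)]

lemma IsFirstEigenfunction.one_le_norm_mul_firstEigenvalue_rpow (hΩ : IsOpen Ω) {p : ℝ} (hp : 1 < p)
    {u : Euc N → ℝ} (h : IsFirstEigenfunction Ω p u) {v : Euc N} (hv : ∀ x ∈ Ω, x + v ∉ Ω) :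
    1 ≤ ‖v‖ * firstEigenvalue Ω p ^ (1 / p) := by
  obtain ⟨G, hW, henergy⟩ := h.1.exists_integral_norm_grad_rpow_eq hp
  have hp0 : 0 < p := by linarith
  have hu : ∫ x in Ω, |u x| ^ p = 1 := by
    rw [← h.2.2.2]
    exact setIntegral_congr_fun hΩ.measurableSet fun x hx => by
      simp only [abs_of_pos (h.2.2.1 x hx)]
  have hpoincare := hW.eLpNorm_le_eLpNorm_grad hp.le hv
  rw [hW.1.eLpNorm_eq_integral_rpow_norm (by simpa using hp0) ENNReal.ofReal_ne_top,
    hW.2.1.eLpNorm_eq_integral_rpow_norm (by simpa using hp0) ENNReal.ofReal_ne_top,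
    ENNReal.toReal_ofReal hp0.le, henergy] at hpoincare
  simp only [Real.norm_eq_abs, hu, Real.one_rpow, mul_one] at hpoincare
  rwa [← ofReal_norm, ← ENNReal.ofReal_mul (norm_nonneg v), ENNReal.ofReal_one,
    ENNReal.one_le_ofReal, ← one_div] at hpoincare

variable {p : ℕ → ℝ} {u : ℕ → Euc N → ℝ} {Lam : ℝ} {uinf : Euc N → ℝ} {f : Measure (Euc N)}

theorem IsLimit.limit_pos (hN : 1 ≤ N) (hΩ : IsOpen Ω) (hΩb : Bornology.IsBounded Ω)
    (h : IsLimit Ω p u Lam uinf f) : 0 < Lam := by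
  have : Nonempty (Fin N) := ⟨⟨0, hN⟩⟩
  obtain ⟨v, hv⟩ := exists_forall_add_notMem_of_isBounded hΩb
  have hbound : ∀ᶠ k in atTop, 1 ≤ ‖v‖ * firstEigenvalue Ω (p k) ^ (1 / p k) := by
    filter_upwards [h.exponent_tendsto.eventually_gt_atTop 1] with k hk
    exact (h.eigenfunction k).one_le_norm_mul_firstEigenvalue_rpow hΩ hk hv
  have := ge_of_tendsto (h.eigenvalue_tendsto.const_mul ‖v‖) hbound
  exact pos_of_mul_pos_right (by linarith) (norm_nonneg v)

theorem IsLimit.isProbabilityMeasure (hΩ : IsOpen Ω) (hΩb : Bornology.IsBounded Ω)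
    (h : IsLimit Ω p u Lam uinf f) : IsProbabilityMeasure f := by
  have : IsFiniteMeasure (volume.restrict Ω) := ⟨by simpa using hΩb.measure_lt_top⟩
  have hΩ_ae : ∀ᵐ x ∂volume.restrict Ω, x ∈ Ω := ae_restrict_mem hΩ.measurableSet
  have hmass : Tendsto (fun k => ∫ x in Ω, u k x ^ (p k - 1)) atTop (𝓝 1) :=
    tendsto_integral_rpow_sub_one
      (fun k => ((h.eigenfunction k).2.1.mono subset_closure).aestronglyMeasurable
        hΩ.measurableSet)
      (fun k => hΩ_ae.mono fun x hx => ((h.eigenfunction k).2.2.1 x hx).le) h.exponent_tendsto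
      (fun k => (h.eigenfunction k).2.2.2) (hΩ_ae.mono fun x hx => subset_closure hx)
      h.uniform_tendsto
  have hlim : Tendsto (fun k => ∫ x in Ω, u k x ^ (p k - 1)) atTop (𝓝 (f.real univ)) := by
    simpa using h.weak_tendsto (fun _ => 1) continuous_const
  exact ⟨(ENNReal.toReal_eq_one_iff _).1 (tendsto_nhds_unique hlim hmass)⟩

end FirstEigenvalue

section MeasurableNearestPoint

-- Taking the least minimising parameter makes the selection measurable: it is at most `a` exactly
-- when the part of the curve with parameters at most `a` already realises the distance.
lemma exists_measurable_param_edist_eq_infEDist {ι E : Type*} [LinearOrder ι] [TopologicalSpace ι]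
    [OrderTopology ι] [SecondCountableTopology ι] [MeasurableSpace ι] [BorelSpace ι]
    [PseudoMetricSpace E] [MeasurableSpace E] [OpensMeasurableSpace E] {C : Set ι}
    (hC : IsCompact C) (hne : C.Nonempty) {g : C → E} (hg : Continuous g) :
    ∃ s : E → C, Measurable s ∧ ∀ x, edist x (g (s x)) = Metric.infEDist x (range g) := by
  have := isCompact_iff_compactSpace.1 hC
  have := hne.to_subtype
  have hleast (x : E) : ∃ t, edist x (g t) = Metric.infEDist x (range g) ∧
      ∀ t', edist x (g t') = Metric.infEDist x (range g) → t ≤ t' := by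
    refine (isClosed_eq (continuous_const.edist hg) continuous_const).isCompact.exists_isLeast ?_
    obtain ⟨_, ⟨t, rfl⟩, ht⟩ :=
      (isCompact_range hg).exists_infEDist_eq_edist (range_nonempty g) x
    exact ⟨t, ht.symm⟩
  choose s hs hs_min using hleast
  refine ⟨s, Measurable.subtype_mk (f := fun x => (s x : ι)) ?_, hs⟩
  refine measurable_of_Iic fun a => ?_
  have hsublevel : (fun x => (s x : ι)) ⁻¹' Iic a =
      {x | Metric.infEDist x (g '' {t | (t : ι) ≤ a}) ≤ Metric.infEDist x (range g)} := by
    ext x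
    refine ⟨fun hx => ?_, fun hx => ?_⟩
    · rw [mem_ofPred_eq, ← hs x]
      exact Metric.infEDist_le_edist_of_mem (mem_image_of_mem g hx)
    have hnonempty : (g '' {t | (t : ι) ≤ a}).Nonempty := by
      by_contra! hempty
      rw [mem_ofPred_eq, hempty, Metric.infEDist_empty, top_le_iff] at hx
      exact Metric.infEDist_ne_top (range_nonempty g) hx
    have hcompact : IsCompact (g '' {t | (t : ι) ≤ a}) :=
      (isClosed_Iic.preimage continuous_subtype_val).isCompact.image hg
    obtain ⟨_, ⟨t, hta, rfl⟩, ht⟩ := hcompact.exists_infEDist_eq_edist hnonempty x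
    rw [mem_ofPred_eq, ht] at hx
    have hmin := hs_min x t (hx.antisymm (Metric.infEDist_le_edist_of_mem (mem_range_self t)))
    exact (Subtype.coe_le_coe.2 hmin).trans hta
  rw [hsublevel]
  exact (isClosed_le Metric.continuous_infEDist Metric.continuous_infEDist).measurableSet

-- A compact metric space is a continuous image of the Cantor set.
theorem exists_measurable_infDist_eq_dist {E : Type*} [MetricSpace E] [MeasurableSpace E]
    [BorelSpace E] {K : Set E} (hK : IsCompact K) (hne : K.Nonempty) :
    ∃ T : E → E, Measurable T ∧ ∀ x, T x ∈ K ∧ Metric.infDist x K = dist x (T x) := by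
  have := hne.to_subtype
  have := isCompact_iff_compactSpace.1 hK
  obtain ⟨c, hc, hsurj⟩ := exists_nat_bool_continuous_surjective_of_compact K
  let g : cantorSet → E := fun t => c (cantorSetHomeomorphNatToBool t)
  have hg : Continuous g :=
    continuous_subtype_val.comp (hc.comp cantorSetHomeomorphNatToBool.continuous)
  have hrange : range g = K := by
    have : range (c ∘ cantorSetHomeomorphNatToBool) = univ :=
      (hsurj.comp cantorSetHomeomorphNatToBool.surjective).range_eq
    rw [show g = Subtype.val ∘ c ∘ cantorSetHomeomorphNatToBool from rfl, range_comp, this,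
      image_univ, Subtype.range_coe]
  obtain ⟨s, hs, hdist⟩ :=
    exists_measurable_param_edist_eq_infEDist isCompact_cantorSet ⟨0, zero_mem_cantorSet⟩ hg
  refine ⟨g ∘ s, hg.measurable.comp hs, fun x => ⟨hrange ▸ mem_range_self (s x), ?_⟩⟩
  rw [Metric.infDist, ← hrange, ← hdist x, dist_edist, Function.comp_apply]

end MeasurableNearestPoint

section DistanceToFrontier

lemma frontier_subset_compl {X : Type*} [TopologicalSpace X] {U : Set X} (hU : IsOpen U) :
    frontier U ⊆ Uᶜ :=
  (disjoint_frontier_iff_isOpen.2 hU).subset_compl_right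

variable {E : Type*} [NormedAddCommGroup E] [NormedSpace ℝ E] {Ω : Set E}

lemma infDist_frontier_eq_infDist_compl [FiniteDimensional ℝ E] (hΩ : IsOpen Ω) (hne : Ω ≠ univ)
    {x : E} (hx : x ∈ closure Ω) : Metric.infDist x (frontier Ω) = Metric.infDist x Ωᶜ := by
  by_cases hxΩ : x ∈ Ω
  · obtain ⟨y, hy, hxy⟩ := exists_mem_frontier_infDist_compl_eq_dist hxΩ hne
    exact (hxy ▸ Metric.infDist_le_dist_of_mem hy).antisymm
      (Metric.infDist_le_infDist_of_subset (frontier_subset_compl hΩ) ⟨y, hy⟩)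
  · have hxfr : x ∈ frontier Ω := hΩ.frontier_eq ▸ ⟨hx, hxΩ⟩
    rw [Metric.infDist_zero_of_mem hxfr, Metric.infDist_zero_of_mem (mem_compl hxΩ)]

end DistanceToFrontier

section LipschitzOfGradient

variable {E : Type*} [NormedAddCommGroup E] [NormedSpace ℝ E]

lemma norm_sub_le_of_ae_norm_fderiv_le_on_segment {u : E → ℝ} {U : Set E} {K : NNReal}
    (hu : LipschitzOnWith K u U) {x v : E} (hseg : ∀ t ∈ Icc (0 : ℝ) 1, x + t • v ∈ U) {C : ℝ}
    (hderiv : ∀ᵐ t : ℝ, t ∈ Ioc (0 : ℝ) 1 →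
      DifferentiableAt ℝ u (x + t • v) ∧ ‖fderiv ℝ u (x + t • v)‖ ≤ C) :
    ‖u (x + v) - u x‖ ≤ C * ‖v‖ := by
  have hline : LipschitzWith ‖v‖₊ fun t : ℝ => x + t • v := by
    refine LipschitzWith.of_dist_le_mul fun a b => ?_
    rw [dist_add_left, dist_eq_norm, ← sub_smul, norm_smul, mul_comm, coe_nnnorm, Real.dist_eq,
      Real.norm_eq_abs]
  have hlip : LipschitzOnWith (K * ‖v‖₊) (fun t : ℝ => u (x + t • v)) (uIcc 0 1) := by
    rw [uIcc_of_le zero_le_one]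
    exact hu.comp hline.lipschitzOnWith hseg
  have hftc := hlip.absolutelyContinuousOnInterval.integral_deriv_eq_sub
  rw [one_smul, zero_smul, add_zero] at hftc
  rw [← hftc]
  refine (intervalIntegral.norm_integral_le_of_norm_le_const_ae (C := C * ‖v‖) ?_).trans_eq
    (by simp)
  filter_upwards [hderiv] with t ht htI
  obtain ⟨hdiff, hle⟩ := ht (uIoc_of_le (zero_le_one' ℝ) ▸ htI)
  have hderiv_line : HasDerivAt (fun t : ℝ => x + t • v) v t := by
    simpa using ((hasDerivAt_id t).smul_const v).const_add x
  have hcomp : HasDerivAt (fun t : ℝ => u (x + t • v)) (fderiv ℝ u (x + t • v) v) t :=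
    hdiff.hasFDerivAt.comp_hasDerivAt t hderiv_line
  rw [hcomp.deriv]
  exact ContinuousLinearMap.le_of_opNorm_le _ hle v

variable [FiniteDimensional ℝ E] [MeasurableSpace E] [BorelSpace E] {μ : Measure E}
  [μ.IsAddHaarMeasure]

lemma ae_ae_add_smul_of_ae {P : E → Prop} (hP : ∀ᵐ x ∂μ, P x) (v : E) :
    ∀ᵐ x ∂μ, ∀ᵐ t : ℝ, P (x + t • v) := by
  obtain ⟨s, hs, hs_meas, hs_null⟩ := exists_measurable_superset_of_null hP
  have hline := (ae_ae_add_linearMap_mem_iff (LinearMap.toSpanSingleton ℝ E v) volume μ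
    hs_meas.compl).2 (measure_eq_zero_iff_ae_notMem.1 hs_null)
  filter_upwards [hline] with x hx
  filter_upwards [hx] with t ht
  exact not_not.1 fun hPt => ht (hs hPt)

-- By Fubini the gradient bound holds a.e. on almost every translate of a given segment.
theorem lipschitzOnWith_of_ae_norm_fderiv_le {u : E → ℝ} {U : Set E} (hU : IsOpen U)
    (hconv : Convex ℝ U) {K C : NNReal} (hu : LipschitzOnWith K u U)
    (hfderiv : ∀ᵐ x ∂μ.restrict U, ‖fderiv ℝ u x‖ ≤ C) : LipschitzOnWith C u U := by
  have hgood : ∀ᵐ x ∂μ, x ∈ U → DifferentiableAt ℝ u x ∧ ‖fderiv ℝ u x‖ ≤ C := by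
    rw [ae_restrict_iff' hU.measurableSet] at hfderiv
    filter_upwards [hu.ae_differentiableWithinAt_of_mem (μ := μ), hfderiv] with x hdiff hle hxU
    exact ⟨(hdiff hxU).differentiableAt (hU.mem_nhds hxU), hle hxU⟩
  refine LipschitzOnWith.of_dist_le_mul fun z hz x hx => ?_
  rw [dist_eq_norm, dist_eq_norm]
  obtain ⟨v, rfl⟩ : ∃ v, z = x + v := ⟨z - x, by simp⟩
  rw [add_sub_cancel_left]
  have hshift : Tendsto (fun y => y + v) (𝓝 x) (𝓝 (x + v)) :=
    (continuous_add_const v).tendsto x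
  have hlim : Tendsto (fun y => ‖u (y + v) - u y‖) (𝓝 x) (𝓝 ‖u (x + v) - u x‖) :=
    (((hu.continuousOn.continuousAt (hU.mem_nhds hz)).tendsto.comp hshift).sub
      (hu.continuousOn.continuousAt (hU.mem_nhds hx)).tendsto).norm
  refine le_of_tendsto_of_frequently hlim ?_
  have hfreq := mem_closure_iff_frequently.1
    (Measure.dense_of_ae (ae_ae_add_smul_of_ae hgood v) x)
  have hnear : ∀ᶠ y in 𝓝 x, y ∈ U ∧ y + v ∈ U :=
    (hU.eventually_mem hx).and (hshift.eventually (hU.mem_nhds hz))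
  refine (hfreq.and_eventually hnear).mono ?_
  rintro y ⟨hy : ∀ᵐ t : ℝ, _, hyU, hyvU⟩
  have hseg (t : ℝ) (ht : t ∈ Icc (0 : ℝ) 1) : y + t • v ∈ U := by
    simpa using hconv.add_smul_sub_mem hyU hyvU ht
  exact norm_sub_le_of_ae_norm_fderiv_le_on_segment hu hseg
    (hy.mono fun t ht htI => ht (hseg t (Ioc_subset_Icc_self htI)))

end LipschitzOfGradient

section Admissible

variable {N : ℕ} {Ω : Set (Euc N)} {Lam : ℝ}

lemma IsAdmissible.abs_le (hΩ : IsOpen Ω) (hne : Ω ≠ univ) (hLam : 0 ≤ Lam) {u : Euc N → ℝ}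
    (h : IsAdmissible Ω Lam u) {x : Euc N} (hx : x ∈ closure Ω) :
    |u x| ≤ Lam * Metric.infDist x Ωᶜ := by
  obtain ⟨⟨K, hu⟩, hgrad, hzero⟩ := h
  by_cases hxΩ : x ∈ Ω
  swap
  · simp [hzero x (hΩ.frontier_eq ▸ ⟨hx, hxΩ⟩), Metric.infDist_zero_of_mem (mem_compl hxΩ)]
  obtain ⟨y, hy, hxy⟩ := exists_mem_frontier_infDist_compl_eq_dist hxΩ hne
  rw [hxy]
  have hball : Metric.ball x (dist x y) ⊆ Ω := by
    simpa [hxy] using Metric.ball_infDist_compl_subset (s := Ω) (x := x)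
  have hr : dist x y ≠ 0 := dist_ne_zero.2 fun hxy => frontier_subset_compl hΩ (hxy ▸ hy) hxΩ
  lift Lam to NNReal using hLam
  have hlip : LipschitzOnWith Lam u (Metric.ball x (dist x y)) :=
    lipschitzOnWith_of_ae_norm_fderiv_le Metric.isOpen_ball (convex_ball x _)
      (hu.mono (hball.trans subset_closure))
      ((ae_restrict_of_ae_restrict_of_subset hball hgrad).mono fun w hw => norm_gradient u w ▸ hw)
  have hlip' := hlip.closure (hu.continuousOn.mono (closure_mono hball))
  rw [closure_ball x hr] at hlip'
  have := hlip'.dist_le_mul x (Metric.mem_closedBall_self dist_nonneg) y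
    (by rw [Metric.mem_closedBall, dist_comm])
  rwa [hzero y hy, Real.dist_0_eq_abs] at this

lemma isAdmissible_mul_infDist_compl (hΩ : IsOpen Ω) (hLam : 0 ≤ Lam) :
    IsAdmissible Ω Lam (fun x => Lam * Metric.infDist x Ωᶜ) := by
  lift Lam to NNReal using hLam
  have hlip : LipschitzWith Lam fun x : Euc N => Lam * Metric.infDist x Ωᶜ := by
    simpa [Function.comp_def] using
      (lipschitzWith_smul (Lam : ℝ)).comp (Metric.lipschitz_infDist_pt Ωᶜ)
  refine ⟨⟨Lam, hlip.lipschitzOnWith⟩, ae_of_all _ fun x => ?_, fun x hx => ?_⟩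
  · exact norm_gradient _ x ▸ norm_fderiv_le_of_lipschitz ℝ hlip
  · simp [Metric.infDist_zero_of_mem (frontier_subset_compl hΩ hx)]

end Admissible

section IntegralWithDensity

variable {X E F G : Type*} [MeasurableSpace X] {μ : Measure X}
  [NormedAddCommGroup E] [NormedSpace ℝ E] [NormedAddCommGroup F] [NormedSpace ℝ F]
  [CompleteSpace F] [NormedAddCommGroup G] [NormedSpace ℝ G] [CompleteSpace G]

lemma isFiniteMeasure_variation_withDensityᵥ {w : X → F} (hw : Integrable w μ) :
    IsFiniteMeasure (μ.withDensityᵥ w).variation := by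
  rw [Measure.variation_withDensityᵥ hw]
  exact isFiniteMeasure_withDensity hw.2.ne

lemma integral_simpleFunc_withDensityᵥ (B : E →L[ℝ] F →L[ℝ] G) {w : X → F} (hw : Integrable w μ)
    (g : SimpleFunc X E) : (μ.withDensityᵥ w).integral g B = ∫ x, B (g x) (w x) ∂μ := by
  have := isFiniteMeasure_variation_withDensityᵥ hw
  have hbilin (g : SimpleFunc X E) : Integrable (fun x => B (g x) (w x)) μ := by
    obtain ⟨C, hC⟩ := g.exists_forall_norm_le
    exact B.integrable_of_bilin_of_bdd_left C g.stronglyMeasurable.aestronglyMeasurable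
      (ae_of_all _ hC) hw
  induction g using SimpleFunc.induction with
  | @const c s hs =>
    have hindicator : ⇑((SimpleFunc.const X c).piecewise s hs (SimpleFunc.const X 0)) =
        s.indicator fun _ => c := by
      ext x
      by_cases hx : x ∈ s <;> simp [hx]
    have hB (x : X) :
        B (s.indicator (fun _ => c) x) (w x) = s.indicator (fun y => B c (w y)) x := by
      by_cases hx : x ∈ s <;> simp [hx]
    simp_rw [hindicator, hB]
    rw [VectorMeasure.integral_indicator_const c hs, integral_indicator hs,
      (B c).integral_comp_comm hw.integrableOn, withDensityᵥ_apply hw hs]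
  | @add g₁ g₂ _ h₁ h₂ =>
    rw [SimpleFunc.coe_add, VectorMeasure.integral_add g₁.integrable_of_isFiniteMeasure
      g₂.integrable_of_isFiniteMeasure, h₁, h₂, ← integral_add (hbilin g₁) (hbilin g₂)]
    simp only [Pi.add_apply, map_add, add_apply]

theorem integral_withDensityᵥ_of_norm_le (B : E →L[ℝ] F →L[ℝ] G) {w : X → F}
    (hw : Integrable w μ) {h : X → E} (hh : StronglyMeasurable h) {C : ℝ} (hC : ∀ x, ‖h x‖ ≤ C) :
    (μ.withDensityᵥ w).integral h B = ∫ x, B (h x) (w x) ∂μ := by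
  cases isEmpty_or_nonempty X
  · simp [VectorMeasure.integral_of_isEmpty, Measure.eq_zero_of_isEmpty]
  have hC₀ : 0 ≤ C := (norm_nonneg _).trans (hC (Classical.arbitrary X))
  have := isFiniteMeasure_variation_withDensityᵥ hw
  have hmeas (n : ℕ) (ν : Measure X) : AEStronglyMeasurable (hh.approxBounded C n) ν :=
    (hh.approxBounded C n).stronglyMeasurable.aestronglyMeasurable
  have happrox (x : X) : Tendsto (fun n => hh.approxBounded C n x) atTop (𝓝 (h x)) :=
    hh.tendsto_approxBounded_of_norm_le (hC x)
  have hleft := VectorMeasure.tendsto_integral_of_dominated_convergence (B := B) (fun _ => C)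
    (fun n => hmeas n (μ.withDensityᵥ w).variation) (integrable_const C)
    (fun n => ae_of_all _ (hh.norm_approxBounded_le hC₀ n)) (ae_of_all _ happrox)
  have hright : Tendsto (fun n => ∫ x, B (hh.approxBounded C n x) (w x) ∂μ) atTop
      (𝓝 (∫ x, B (h x) (w x) ∂μ)) := by
    refine tendsto_integral_of_dominated_convergence (fun x => ‖B‖ * C * ‖w x‖)
      (fun n => B.aestronglyMeasurable_comp₂ (hmeas n μ) hw.1) (hw.norm.const_mul _)
      (fun n => ae_of_all _ fun x => ?_)
      (ae_of_all _ fun x => ((B.flip (w x)).continuous.tendsto _).comp (happrox x))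
    grw [B.le_opNorm₂, hh.norm_approxBounded_le hC₀ n x]
  simp_rw [integral_simpleFunc_withDensityᵥ B hw] at hleft
  exact tendsto_nhds_unique hleft hright

end IntegralWithDensity

section TransportFlux

variable {E : Type*} [NormedAddCommGroup E] [NormedSpace ℝ E] [MeasurableSpace E]

/-- The flux of a transport plan `γ`: each pair `(x, y)` contributes the vector `x - y`, spread
uniformly over the segment from `x` to `y`. The orientation is the one for which minus the
divergence is the first marginal minus the second. -/
noncomputable def transportFlux (γ : Measure (E × E)) : VectorMeasure E E :=
  ((γ.prod (volume.restrict (Ioc (0 : ℝ) 1))).withDensityᵥ fun z => z.1.1 - z.1.2).map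
    fun z => z.1.1 + z.2 • (z.1.2 - z.1.1)

variable [BorelSpace E] [SecondCountableTopology E] [CompleteSpace E] {γ : Measure (E × E)}

lemma variation_transportFlux_le (hγ : Integrable (fun z => z.1 - z.2) γ) :
    (transportFlux γ).variation univ ≤ ENNReal.ofReal (∫ z, ‖z.1 - z.2‖ ∂γ) := by
  have hsegment : Measurable fun z : (E × E) × ℝ => z.1.1 + z.2 • (z.1.2 - z.1.1) := by fun_prop
  refine (VectorMeasure.variation_map_le univ).trans ?_
  rw [Measure.map_apply hsegment MeasurableSet.univ, preimage_univ,
    Measure.variation_withDensityᵥ (hγ.comp_fst _), withDensity_apply _ MeasurableSet.univ,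
    Measure.restrict_univ, ofReal_integral_norm_eq_lintegral_enorm hγ,
    lintegral_prod _ (by fun_prop)]
  simp

lemma integral_transportFlux [SFinite γ] (hγ : Integrable (fun z => z.1 - z.2) γ)
    {F G : Type*} [NormedAddCommGroup F] [NormedSpace ℝ F] [NormedAddCommGroup G] [NormedSpace ℝ G]
    [CompleteSpace G] (B : F →L[ℝ] E →L[ℝ] G) {h : E → F} (hh : StronglyMeasurable h) {C : ℝ}
    (hC : ∀ x, ‖h x‖ ≤ C) :
    (transportFlux γ).integral h B =
      ∫ z, (∫ t in (0 : ℝ)..1, B (h (z.1 + t • (z.2 - z.1))) (z.1 - z.2)) ∂γ := by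
  have hsegment : Measurable fun z : (E × E) × ℝ => z.1.1 + z.2 • (z.1.2 - z.1.1) := by fun_prop
  have hcomp : StronglyMeasurable fun z : (E × E) × ℝ => h (z.1.1 + z.2 • (z.1.2 - z.1.1)) :=
    hh.comp_measurable hsegment
  have hdir := hγ.comp_fst (volume.restrict (Ioc (0 : ℝ) 1))
  have := isFiniteMeasure_variation_withDensityᵥ hdir
  simp_rw [intervalIntegral.integral_of_le zero_le_one]
  rw [transportFlux, VectorMeasure.integral_map hsegment hh.aestronglyMeasurable
    (Integrable.of_bound hcomp.aestronglyMeasurable C (ae_of_all _ fun z => hC _)),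
    integral_withDensityᵥ_of_norm_le B hdir hcomp (fun z => hC _),
    integral_prod _ (B.integrable_of_bilin_of_bdd_left C hcomp.aestronglyMeasurable
      (ae_of_all _ fun z => hC _) hdir)]

theorem negDivEq_transportFlux {N : ℕ} {γ : Measure (Euc N × Euc N)} [IsFiniteMeasure γ]
    (hγ : Integrable (fun z => z.1 - z.2) γ) :
    NegDivEq (transportFlux γ) (γ.map Prod.fst) (γ.map Prod.snd) := by
  intro φ hφ
  obtain ⟨C, hC⟩ :=
    hφ.hasCompactSupport_gradient.exists_bound_of_continuous hφ.continuous_gradient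
  have hsegment (z : Euc N × Euc N) : ∫ t in (0 : ℝ)..1,
      innerSL ℝ (gradient φ (z.1 + t • (z.2 - z.1))) (z.1 - z.2) = φ z.1 - φ z.2 := by
    have hftc := integral_fderiv_add_smul hφ.contDiff_one z.1 (z.2 - z.1)
    rw [add_sub_cancel] at hftc
    simp_rw [innerSL_apply_apply, inner_gradient_left, ← neg_sub z.2 z.1, map_neg]
    rw [intervalIntegral.integral_neg, hftc, neg_sub]
  have hcont := hφ.1.continuous
  have hfst : Integrable (fun z => φ z.1) γ :=
    (hφ.integrable (γ.map Prod.fst)).comp_measurable measurable_fst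
  have hsnd : Integrable (fun z => φ z.2) γ :=
    (hφ.integrable (γ.map Prod.snd)).comp_measurable measurable_snd
  rw [integral_transportFlux hγ (innerSL ℝ) hφ.continuous_gradient.stronglyMeasurable hC,
    integral_map measurable_fst.aemeasurable hcont.aestronglyMeasurable,
    integral_map measurable_snd.aemeasurable hcont.aestronglyMeasurable,
    ← integral_sub hfst hsnd]
  simp_rw [hsegment]

end TransportFlux

section Mollification

open scoped Convolution

variable {E F : Type*} [NormedAddCommGroup E] [NormedSpace ℝ E] [FiniteDimensional ℝ E]
  [MeasurableSpace E] [BorelSpace E] [NormedAddCommGroup F] [NormedSpace ℝ F]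
  {μ : Measure E} [μ.IsAddHaarMeasure] {v : E → F} {K : NNReal}

lemma lipschitzWith_normed_convolution (b : ContDiffBump (0 : E)) (hv : LipschitzWith K v) :
    LipschitzWith K (b.normed μ ⋆[ContinuousLinearMap.lsmul ℝ ℝ, μ] v) := by
  have hexists : ConvolutionExists (b.normed μ) v (ContinuousLinearMap.lsmul ℝ ℝ) μ :=
    b.hasCompactSupport_normed.convolutionExists_left _ b.continuous_normed
      hv.continuous.locallyIntegrable
  refine LipschitzWith.of_dist_le_mul fun x y => ?_
  rw [dist_eq_norm, convolution_def, convolution_def, ← integral_sub (hexists x) (hexists y)]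
  calc _ ≤ ∫ t, b.normed μ t * (K * dist x y) ∂μ := by
        refine norm_integral_le_of_norm_le (b.integrable_normed.mul_const _)
          (ae_of_all _ fun t => ?_)
        rw [← map_sub, ContinuousLinearMap.lsmul_apply, norm_smul,
          Real.norm_of_nonneg (b.nonneg_normed t), ← dist_eq_norm, ← dist_sub_right x y t]
        gcongr
        · exact b.nonneg_normed t
        · exact hv.dist_le_mul _ _
    _ = K * dist x y := by rw [integral_mul_const, b.integral_normed, one_mul]

theorem exists_contDiff_lipschitzWith_dist_le [CompleteSpace F] (hv : LipschitzWith K v)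
    (hv_supp : HasCompactSupport v) {ε : ℝ} (hε : 0 < ε) :
    ∃ φ : E → F, ContDiff ℝ ∞ φ ∧ HasCompactSupport φ ∧ LipschitzWith K φ ∧
      ∀ x, dist (φ x) (v x) ≤ ε := by
  have hr : 0 < ε / (K + 1) := by positivity
  obtain ⟨b, hb⟩ : ∃ b : ContDiffBump (0 : E), b.rOut = ε / (K + 1) :=
    ⟨⟨ε / (K + 1) / 2, ε / (K + 1), half_pos hr, half_lt_self hr⟩, rfl⟩
  have hlip := lipschitzWith_normed_convolution (μ := .addHaar) b hv
  have hsmooth : ContDiff ℝ ∞ (b.normed .addHaar ⋆[ContinuousLinearMap.lsmul ℝ ℝ, .addHaar] v) :=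
    b.hasCompactSupport_normed.contDiff_convolution_left _ b.contDiff_normed
      hv.continuous.locallyIntegrable
  have hsupp : HasCompactSupport
      (b.normed .addHaar ⋆[ContinuousLinearMap.lsmul ℝ ℝ, .addHaar] v) :=
    b.hasCompactSupport_normed.convolution _ hv_supp
  refine ⟨_, hsmooth, hsupp, hlip, fun x => ?_⟩
  refine b.dist_normed_convolution_le hv.continuous.aestronglyMeasurable fun y hy => ?_
  calc dist (v y) (v x) ≤ K * dist y x := hv.dist_le_mul y x
    _ ≤ (K + 1) * (ε / (K + 1)) := by
        gcongr
        · linarith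
        · exact hb ▸ (Metric.mem_ball.1 hy).le
    _ = ε := mul_div_cancel₀ ε (by positivity)

end Mollification

section WeakDuality

variable {N : ℕ} {σ : VectorMeasure (Euc N) (Euc N)} {f ν : Measure (Euc N)} {K : NNReal}

lemma NegDivEq.sub_le_variation_of_isTestFunction (h : NegDivEq σ f ν)
    (hσ : σ.variation univ ≠ ⊤) {φ : Euc N → ℝ} (hφ : IsTestFunction univ φ)
    (hlip : LipschitzWith K φ) :
    ∫ x, φ x ∂f - ∫ x, φ x ∂ν ≤ K * (σ.variation univ).toReal := by
  have : IsFiniteMeasure σ.variation := ⟨hσ.lt_top⟩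
  have hgrad (x : Euc N) : ‖gradient φ x‖ ≤ K :=
    norm_gradient φ x ▸ norm_fderiv_le_of_lipschitz ℝ hlip
  have hbound : ‖σ.integral (gradient φ) (innerSL ℝ)‖ ≤
      K * ‖innerSL ℝ (E := Euc N)‖ * (σ.variation univ).toReal :=
    VectorMeasure.norm_integral_le_of_norm_le_const (ae_of_all _ hgrad)
  rw [← h φ hφ]
  refine (Real.le_norm_self _).trans (hbound.trans ?_)
  gcongr
  exact mul_le_of_le_one_right K.2 (norm_innerSL_le ℝ)

theorem NegDivEq.sub_le_variation [IsFiniteMeasure f] [IsFiniteMeasure ν] (h : NegDivEq σ f ν)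
    (hσ : σ.variation univ ≠ ⊤) {v : Euc N → ℝ} (hv : LipschitzWith K v)
    (hv_supp : HasCompactSupport v) :
    ∫ x, v x ∂f - ∫ x, v x ∂ν ≤ K * (σ.variation univ).toReal := by
  refine le_of_forall_pos_le_add fun δ hδ => ?_
  obtain ⟨ε, hε, hεδ⟩ := exists_pos_mul_lt hδ (f.real univ + ν.real univ)
  obtain ⟨φ, hsmooth, hsupp, hlip, hdist⟩ := exists_contDiff_lipschitzWith_dist_le hv hv_supp hε
  have hφ : IsTestFunction univ φ := ⟨hsmooth, hsupp, subset_univ _⟩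
  have hclose (m : Measure (Euc N)) [IsFiniteMeasure m] :
      |∫ x, φ x ∂m - ∫ x, v x ∂m| ≤ ε * m.real univ := by
    rw [← integral_sub (hφ.integrable m) (hv.continuous.integrable_of_hasCompactSupport hv_supp)]
    exact norm_integral_le_of_norm_le_const (f := fun x => φ x - v x) (ae_of_all _ hdist)
  have hφ_le := h.sub_le_variation_of_isTestFunction hσ hφ hlip
  linarith [(abs_le.1 (hclose f)).1, (abs_le.1 (hclose ν)).2]

end WeakDuality

section NearestPointPlan

variable {X : Type*} [MeasurableSpace X]

lemma integral_infDist_fst_le_integral_dist [PseudoMetricSpace X] {S : Set X}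
    {γ : Measure (X × X)} (hγ : Integrable (fun z => dist z.1 z.2) γ) (hS : ∀ᵐ z ∂γ, z.2 ∈ S) :
    ∫ z, Metric.infDist z.1 S ∂γ ≤ ∫ z, dist z.1 z.2 ∂γ :=
  integral_mono_of_nonneg (ae_of_all _ fun _ => Metric.infDist_nonneg) hγ
    (hS.mono fun _ hz => Metric.infDist_le_dist_of_mem hz)

theorem exists_map_fst_eq_and_ae_dist_eq_infDist [MetricSpace X] [SecondCountableTopology X]
    [BorelSpace X] {K : Set X} (hK : IsCompact K) (hne : K.Nonempty) (f : Measure X) :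
    ∃ γ : Measure (X × X), γ.map Prod.fst = f ∧
      ∀ᵐ z ∂γ, z.2 ∈ K ∧ dist z.1 z.2 = Metric.infDist z.1 K := by
  obtain ⟨T, hT, hTK⟩ := exists_measurable_infDist_eq_dist hK hne
  have hgraph : Measurable fun x => (x, T x) := measurable_id.prodMk hT
  have hclosed : IsClosed {z : X × X | z.2 ∈ K ∧ dist z.1 z.2 = Metric.infDist z.1 K} :=
    (hK.isClosed.preimage continuous_snd).inter
      (isClosed_eq continuous_dist ((Metric.continuous_infDist_pt K).comp continuous_fst))
  refine ⟨f.map fun x => (x, T x), ?_, ?_⟩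
  · rw [Measure.map_map measurable_fst hgraph]
    exact Measure.map_id
  · rw [ae_map_iff hgraph.aemeasurable hclosed.measurableSet]
    exact ae_of_all _ fun x => ⟨(hTK x).1, (hTK x).2.symm⟩

end NearestPointPlan

section BoundaryPlan

lemma integrable_of_ae_mem_isCompact {X F : Type*} [TopologicalSpace X] [T2Space X]
    [MeasurableSpace X] [OpensMeasurableSpace X] [NormedAddCommGroup F] {μ : Measure X}
    [IsFiniteMeasureOnCompacts μ] {K : Set X} (hK : IsCompact K) (hμ : ∀ᵐ x ∂μ, x ∈ K) {g : X → F}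
    (hg : ContinuousOn g K) : Integrable g μ := by
  rw [← Measure.restrict_eq_self_of_ae_mem hμ]
  exact hg.integrableOn_compact hK

variable {N : ℕ} {Ω : Set (Euc N)} {f : Measure (Euc N)}

/-- `γ` is a transport plan from `f` to some probability measure on the boundary of `Ω`, that is,
a competitor in the Kantorovich problem of `kantorovichValues`. -/
structure IsBoundaryPlan (Ω : Set (Euc N)) (f : Measure (Euc N))
    (γ : Measure (Euc N × Euc N)) : Prop where
  map_fst : γ.map Prod.fst = f
  map_snd : γ.map Prod.snd ∈ ProbOn (frontier Ω)

namespace IsBoundaryPlan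

variable {γ : Measure (Euc N × Euc N)}

lemma isProbabilityMeasure (h : IsBoundaryPlan Ω f γ) : IsProbabilityMeasure γ :=
  have := h.map_snd.1
  Measure.isProbabilityMeasure_of_map Prod.snd

lemma ae_snd_mem_frontier (h : IsBoundaryPlan Ω f γ) : ∀ᵐ z ∂γ, z.2 ∈ frontier Ω :=
  ae_of_ae_map measurable_snd.aemeasurable (mem_ae_iff.2 h.map_snd.2)

lemma ae_mem_closure_prod (h : IsBoundaryPlan Ω f γ) (hf : ∀ᵐ x ∂f, x ∈ closure Ω) :
    ∀ᵐ z ∂γ, z ∈ closure Ω ×ˢ closure Ω := by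
  have hfst : ∀ᵐ z ∂γ, z.1 ∈ closure Ω :=
    ae_of_ae_map measurable_fst.aemeasurable (h.map_fst.symm ▸ hf)
  filter_upwards [hfst, h.ae_snd_mem_frontier] with z hz₁ hz₂
  exact ⟨hz₁, frontier_subset_closure hz₂⟩

lemma integrable_sub (h : IsBoundaryPlan Ω f γ) (hΩb : Bornology.IsBounded Ω)
    (hf : ∀ᵐ x ∂f, x ∈ closure Ω) : Integrable (fun z => z.1 - z.2) γ := by
  have := h.isProbabilityMeasure
  exact integrable_of_ae_mem_isCompact (hΩb.isCompact_closure.prod hΩb.isCompact_closure)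
    (h.ae_mem_closure_prod hf) (continuous_fst.sub continuous_snd).continuousOn

lemma integral_infDist_fst (h : IsBoundaryPlan Ω f γ) (S : Set (Euc N)) :
    ∫ z, Metric.infDist z.1 S ∂γ = ∫ x, Metric.infDist x S ∂f := by
  rw [← h.map_fst, integral_map measurable_fst.aemeasurable
    (Metric.continuous_infDist_pt S).aestronglyMeasurable]

lemma integral_infDist_compl_le (h : IsBoundaryPlan Ω f γ) (hΩ : IsOpen Ω)
    (hΩb : Bornology.IsBounded Ω) (hf : ∀ᵐ x ∂f, x ∈ closure Ω) :
    ∫ x, Metric.infDist x Ωᶜ ∂f ≤ ∫ z, ‖z.1 - z.2‖ ∂γ := by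
  have hdist := (h.integrable_sub hΩb hf).norm
  simp only [← dist_eq_norm] at hdist ⊢
  rw [← h.integral_infDist_fst]
  exact integral_infDist_fst_le_integral_dist hdist
    (h.ae_snd_mem_frontier.mono fun _ hz => frontier_subset_compl hΩ hz)

end IsBoundaryPlan

theorem exists_isBoundaryPlan_integral_norm_sub_eq [IsProbabilityMeasure f] (hΩ : IsOpen Ω)
    (hΩb : Bornology.IsBounded Ω) (hne : Ω ≠ univ)
    (hf : ∀ᵐ x ∂f, x ∈ closure Ω) :
    ∃ γ, IsBoundaryPlan Ω f γ ∧ ∫ z, ‖z.1 - z.2‖ ∂γ = ∫ x, Metric.infDist x Ωᶜ ∂f := by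
  have hcompact : IsCompact (frontier Ω) :=
    hΩb.isCompact_closure.of_isClosed_subset isClosed_frontier frontier_subset_closure
  obtain ⟨γ, hfst, hγ⟩ := exists_map_fst_eq_and_ae_dist_eq_infDist hcompact
    (nonempty_frontier_iff.2 ⟨closure_nonempty_iff.1 hf.exists, hne⟩) f
  have : IsProbabilityMeasure (γ.map Prod.fst) := hfst.symm ▸ ‹_›
  have := Measure.isProbabilityMeasure_of_map (μ := γ) Prod.fst
  have hsnd : ∀ᵐ y ∂γ.map Prod.snd, y ∈ frontier Ω :=
    (ae_map_iff measurable_snd.aemeasurable isClosed_frontier.measurableSet).2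
      (hγ.mono fun _ hz => hz.1)
  have hplan : IsBoundaryPlan Ω f γ :=
    ⟨hfst, Measure.isProbabilityMeasure_map measurable_snd.aemeasurable, mem_ae_iff.1 hsnd⟩
  refine ⟨γ, hplan, ?_⟩
  rw [← hplan.integral_infDist_fst]
  refine integral_congr_ae ?_
  filter_upwards [hγ, hplan.ae_mem_closure_prod hf] with z ⟨_, hz⟩ hz_mem
  rw [← dist_eq_norm, hz, infDist_frontier_eq_infDist_compl hΩ hne hz_mem.1]

theorem isLeast_kantorovichValues [IsProbabilityMeasure f] (hΩ : IsOpen Ω)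
    (hΩb : Bornology.IsBounded Ω) (hne : Ω ≠ univ)
    (hf : ∀ᵐ x ∂f, x ∈ closure Ω) :
    IsLeast (kantorovichValues Ω f) (∫ x, Metric.infDist x Ωᶜ ∂f) := by
  constructor
  · obtain ⟨γ, h, hγ⟩ := exists_isBoundaryPlan_integral_norm_sub_eq hΩ hΩb hne hf
    refine ⟨γ, h.map_fst, h.map_snd, ?_⟩
    rw [Measure.restrict_eq_self_of_ae_mem (h.ae_mem_closure_prod hf), hγ]
  · rintro _ ⟨γ, hfst, hsnd, rfl⟩
    have h : IsBoundaryPlan Ω f γ := ⟨hfst, hsnd⟩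
    rw [Measure.restrict_eq_self_of_ae_mem (h.ae_mem_closure_prod hf)]
    exact h.integral_infDist_compl_le hΩ hΩb hf

end BoundaryPlan

section ExtremalProblems

variable {N : ℕ} {Ω : Set (Euc N)} {f : Measure (Euc N)} {Lam : ℝ}

theorem isLeast_primalValues [IsFiniteMeasure f] (hΩ : IsOpen Ω) (hΩb : Bornology.IsBounded Ω)
    (hne : Ω ≠ univ) (hf : ∀ᵐ x ∂f, x ∈ closure Ω) (hLam : 0 ≤ Lam) :
    IsLeast (primalValues Ω Lam f) (-(Lam * ∫ x, Metric.infDist x Ωᶜ ∂f)) := by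
  have hrestrict := Measure.restrict_eq_self_of_ae_mem hf
  constructor
  · exact ⟨_, isAdmissible_mul_infDist_compl hΩ hLam, by rw [hrestrict, integral_const_mul]⟩
  · rintro _ ⟨u, hu, rfl⟩
    obtain ⟨K, hK⟩ := hu.1
    rw [neg_le_neg_iff, ← integral_const_mul, hrestrict]
    have hint {g : Euc N → ℝ} (hg : ContinuousOn g (closure Ω)) : Integrable g f :=
      integrable_of_ae_mem_isCompact hΩb.isCompact_closure hf hg
    refine integral_mono_ae (hint hK.continuousOn)
      ((hint (Metric.continuous_infDist_pt Ωᶜ).continuousOn).const_mul Lam) ?_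
    exact hf.mono fun x hx => (le_abs_self _).trans (hu.abs_le hΩ hne hLam hx)

lemma NegDivEq.integral_infDist_compl_le [IsFiniteMeasure f] (hΩ : IsOpen Ω)
    (hΩb : Bornology.IsBounded Ω) {ν : Measure (Euc N)} (hν : ν ∈ ProbOn (frontier Ω))
    {σ : VectorMeasure (Euc N) (Euc N)} (hσ : σ.variation univ ≠ ⊤) (h : NegDivEq σ f ν) :
    ∫ x, Metric.infDist x Ωᶜ ∂f ≤ (σ.variation univ).toReal := by
  have := hν.1
  have hsupp : HasCompactSupport fun x => Metric.infDist x Ωᶜ :=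
    HasCompactSupport.intro hΩb.isCompact_closure fun x hx =>
      Metric.infDist_zero_of_mem fun hxΩ => hx (subset_closure hxΩ)
  have hzero : ∫ x, Metric.infDist x Ωᶜ ∂ν = 0 := by
    have hν_mem : ∀ᵐ x ∂ν, x ∈ frontier Ω := mem_ae_iff.2 hν.2
    exact integral_eq_zero_of_ae (hν_mem.mono fun x hx =>
      Metric.infDist_zero_of_mem (frontier_subset_compl hΩ hx))
  simpa [hzero] using h.sub_le_variation hσ (Metric.lipschitz_infDist_pt Ωᶜ) hsupp

theorem isLeast_dualValues [IsProbabilityMeasure f] (hΩ : IsOpen Ω)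
    (hΩb : Bornology.IsBounded Ω) (hne : Ω ≠ univ)
    (hf : ∀ᵐ x ∂f, x ∈ closure Ω) (hLam : 0 ≤ Lam) :
    IsLeast (dualValues Ω Lam f) (Lam * ∫ x, Metric.infDist x Ωᶜ ∂f) := by
  constructor
  · obtain ⟨γ, h, hγ⟩ := exists_isBoundaryPlan_integral_norm_sub_eq hΩ hΩb hne hf
    have := h.isProbabilityMeasure
    have hsub := h.integrable_sub hΩb hf
    have hvar := hγ ▸ variation_transportFlux_le hsub
    have hfin := (hvar.trans_lt ENNReal.ofReal_lt_top).ne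
    have hdiv : NegDivEq (transportFlux γ) f (γ.map Prod.snd) :=
      h.map_fst ▸ negDivEq_transportFlux hsub
    refine ⟨_, h.map_snd, _, hfin, hdiv, congrArg (Lam * ·) ?_⟩
    exact (hdiv.integral_infDist_compl_le hΩ hΩb h.map_snd hfin).antisymm
      (ENNReal.toReal_le_of_le_ofReal (integral_nonneg fun _ => Metric.infDist_nonneg) hvar)
  · rintro _ ⟨ν, hν, σ, hσ, h, rfl⟩
    exact mul_le_mul_of_nonneg_left (h.integral_infDist_compl_le hΩ hΩb hν hσ) hLam

end ExtremalProblems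

end InftyEigenvalue

theorem mainTheorem7 {N : ℕ} (hN : 1 ≤ N) (Ω : Set (InftyEigenvalue.Euc N))
    (hΩ : IsOpen Ω) (hΩb : Bornology.IsBounded Ω)
    (p : ℕ → ℝ) (u : ℕ → InftyEigenvalue.Euc N → ℝ)
    (Lam : ℝ) (uinf : InftyEigenvalue.Euc N → ℝ) (f : Measure (InftyEigenvalue.Euc N))
    (hlim : InftyEigenvalue.IsLimit Ω p u Lam uinf f) :
    0 < Lam ∧ ∃ m mstar : ℝ,
      IsLeast (InftyEigenvalue.primalValues Ω Lam f) m ∧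
      IsLeast (InftyEigenvalue.dualValues Ω Lam f) mstar ∧
      IsGLB (InftyEigenvalue.kantorovichValues Ω f) (-(1 / Lam) * m) ∧
      -(1 / Lam) * m = (1 / Lam) * mstar := by
  have : Nonempty (Fin N) := ⟨⟨0, hN⟩⟩
  have hLam := hlim.limit_pos hN hΩ hΩb
  have := hlim.isProbabilityMeasure hΩ hΩb
  have hne : Ω ≠ univ := fun h => NormedSpace.unbounded_univ ℝ (InftyEigenvalue.Euc N) (h ▸ hΩb)
  have hf : ∀ᵐ x ∂f, x ∈ closure Ω := mem_ae_iff.2 hlim.concentrated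
  have hK := InftyEigenvalue.isLeast_kantorovichValues hΩ hΩb hne hf
  refine ⟨hLam, _, _, InftyEigenvalue.isLeast_primalValues hΩ hΩb hne hf hLam.le,
    InftyEigenvalue.isLeast_dualValues hΩ hΩb hne hf hLam.le, ?_, by ring⟩
  rw [neg_mul_neg, one_div, inv_mul_cancel_left₀ hLam.ne']
  exact hK.isGLB
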